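/- There is a universal constant $C>0$ such that the following holds for all integers $n,k,d\ge 1$, all reals $\sigma>0$, $B>0$, and every parameter set $\Theta\subseteq\mathbb R^d$ with $[-B,B]^d\subseteq\Theta$ and $nB^2\min\{k,d\}\ge d\sigma^2$. For $\theta\in\Theta$ let $X_1,\dots,X_n$ be i.i.d. with law $\mathcal N(\theta,\sigma^2I_d)$, where $X_i$ is observed by node $i$. Let $Y$ be the transcript produced from $X_1,\dots,X_n$ by a communication protocol of one of the following three types. 1. *Independent:* node $i$ sends $M_i\in[2^k]$ drawn from a regular conditional probability $p_i(m\mid X_i)$, independently across nodes given the samples; $Y=(M_1,\dots,M_n)$. 2. *Sequential:* node $i$ sends $M_i\in[2^k]$ drawn from a regular conditional probability $p_i(m\mid X_i;M_1,\dots,M_{i-1})$ that may depend on the earlier messages; $Y=(M_1,\dots,M_n)$. 3. *Blackboard:* the protocol is a complete binary tree of depth $nk$. Each internal vertex $v$ carries a label $l_v\in\{1,\dots,n\}$ and a measurable function $b_v:\mathbb R^d\to[0,1]$, and every root-to-leaf path visits exactly $k$ internal vertices with label $i$, for each $i$. At vertex $v$, node $l_v$ writes the bit $1$ with probability $b_v(X_{l_v})$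 and the bit $0$ otherwise, with fresh randomness at each vertex, and the protocol moves to the corresponding child; $Y\in\{0,1\}^{nk}$ is the string of bits written. Then for every estimator $\hat\theta=\hat\theta(Y)\in\mathbb R^d$, $$\sup_{\theta\in\Theta}\mathbb E_\theta\|\hat\theta(Y)-\theta\|_2^2\;\ge\; C\,\sigma^2\max\left\{\frac{d^2}{nk},\,\frac dn\right\}.$$ In particular $C$ does not depend on $n,k,d,\sigma,B,\Theta$, the protocol or the estimator. -/

import Mathlib

open MeasureTheory ProbabilityTheory
open scoped ENNReal

noncomputable section

/-- The entries of `y` with index smaller than `t`: what has been communicated before time `t`. -/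
def before {N : ℕ} {A : Type*} (y : Fin N → A) (t : Fin N) : Fin (t : ℕ) → A :=
  fun s => y (s.castLE t.isLt.le)

/-- Independent protocols for `n` nodes with samples in `𝒳` and `k` bits per node: node `i` encodes
its sample `x` into a message `m ∈ [2 ^ k]` with conditional probability `q i x {m}`. -/
structure IndependentProtocol (n k : ℕ) (𝒳 : Type*) [MeasurableSpace 𝒳] where
  q : Fin n → Kernel 𝒳 (Fin (2 ^ k))
  isMarkovKernel : ∀ i, IsMarkovKernel (q i)

/-- Conditional probability of the transcript `y = (m₁, …, mₙ)` given the samples `x₁, …, xₙ`. -/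
def IndependentProtocol.condProb {n k : ℕ} {𝒳 : Type*} [MeasurableSpace 𝒳]
    (P : IndependentProtocol n k 𝒳) (x : Fin n → 𝒳) (y : Fin n → Fin (2 ^ k)) : ℝ≥0∞ :=
  ∏ i, P.q i (x i) {y i}

/-- Sequential protocols: the quantization strategy of node `i` may depend on the previous messages
`m₁, …, mᵢ₋₁`; it sends `m` with conditional probability `q i (m₁, …, mᵢ₋₁) x {m}`. -/
structure SequentialProtocol (n k : ℕ) (𝒳 : Type*) [MeasurableSpace 𝒳] where
  q : (i : Fin n) → (Fin (i : ℕ) → Fin (2 ^ k)) → Kernel 𝒳 (Fin (2 ^ k))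
  isMarkovKernel : ∀ i m, IsMarkovKernel (q i m)

/-- Conditional probability of the transcript `y = (m₁, …, mₙ)` given the samples `x₁, …, xₙ`. -/
def SequentialProtocol.condProb {n k : ℕ} {𝒳 : Type*} [MeasurableSpace 𝒳]
    (P : SequentialProtocol n k 𝒳) (x : Fin n → 𝒳) (y : Fin n → Fin (2 ^ k)) : ℝ≥0∞ :=
  ∏ i, P.q i (before y i) (x i) {y i}

/-- Blackboard protocols. The protocol is a complete binary tree of depth `n * k`. An internal node
of the tree at depth `t` is the string `v` of the `t` bits written so far, and `label t v` is the
identity of the node of the network that writes the next bit. With sample `x` this node writes `1`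
(`true`) with probability `bitProb t v x` and `0` (`false`) otherwise. On every path from the root to
a leaf each node of the network writes exactly `k` bits. -/
structure BlackboardProtocol (n k : ℕ) (𝒳 : Type*) [MeasurableSpace 𝒳] where
  label : (t : Fin (n * k)) → (Fin (t : ℕ) → Bool) → Fin n
  bitProb : (t : Fin (n * k)) → (Fin (t : ℕ) → Bool) → 𝒳 → ℝ
  measurable_bitProb : ∀ t v, Measurable (bitProb t v)
  bitProb_mem : ∀ t v x, bitProb t v x ∈ Set.Icc (0 : ℝ) 1
  card_label : ∀ (y : Fin (n * k) → Bool) (i : Fin n),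
    (Finset.univ.filter fun t => label t (before y t) = i).card = k

/-- Conditional probability of the transcript `y ∈ {0,1}^(nk)` given the samples `x₁, …, xₙ`. -/
def BlackboardProtocol.condProb {n k : ℕ} {𝒳 : Type*} [MeasurableSpace 𝒳]
    (P : BlackboardProtocol n k 𝒳) (x : Fin n → 𝒳) (y : Fin (n * k) → Bool) : ℝ≥0∞ :=
  ∏ t, ENNReal.ofReal
    (if y t = true then P.bitProb t (before y t) (x (P.label t (before y t)))
      else 1 - P.bitProb t (before y t) (x (P.label t (before y t))))

/-- The law `N(θ, σ² I_d)` of a single sample in the Gaussian location model. -/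
def gaussianLocation (d : ℕ) (σ : ℝ) (θ : EuclideanSpace ℝ (Fin d)) :
    Measure (EuclideanSpace ℝ (Fin d)) :=
  multivariateGaussian θ (σ ^ 2 • (1 : Matrix (Fin d) (Fin d) ℝ))

/-- Probability of the transcript `y`, when `p x y` is its conditional probability given the samples
`x = (x₁, …, xₙ)` and the samples are i.i.d. with law `μ`. -/
def transcriptProb {n : ℕ} {𝒳 Y : Type*} [MeasurableSpace 𝒳]
    (μ : Measure 𝒳) (p : (Fin n → 𝒳) → Y → ℝ≥0∞) (y : Y) : ℝ≥0∞ :=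
  ∫⁻ x, p x y ∂(Measure.pi fun _ : Fin n => μ)

/-- The risk `E_θ ‖θ̂(Y) - θ‖₂²` of the estimator `est` from the transcript `Y`, in the Gaussian
location model. -/
def gaussianRisk {n d : ℕ} {Y : Type*} [Fintype Y] (σ : ℝ)
    (p : (Fin n → EuclideanSpace ℝ (Fin d)) → Y → ℝ≥0∞) (est : Y → EuclideanSpace ℝ (Fin d))
    (θ : EuclideanSpace ℝ (Fin d)) : ℝ≥0∞ :=
  ∑ y, transcriptProb (gaussianLocation d σ θ) p y * ENNReal.ofReal (‖est y - θ‖ ^ 2)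

end

/-! In all three models the conditional law of the transcript factors as `∏ i, g i (x i) y` with `0
≤ g ≤ 1`. Beyond this (`IsProductTranscript`), only the number `2 ^ (n * k)` of transcripts matters.

For i.i.d. samples, Fubini gives `P_θ(y) = ∏ i, G_i(y)` with `G_i(y) = E_θ[g i X y]`, and the score
of the transcript is the sum over nodes of the conditional means of the Gaussian score. Cross terms
between nodes cancel, so the trace of the Fisher information is a sum over nodes. It has two bounds.
Conditioning contracts second moments, which gives `d n / σ²` (`fisherTrace_le_dim`). Moreover,
conditioning on a weight of mass `G_i` shifts the mean of a Gaussian score by at most `2 σ⁻² log (1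
/ G_i)` in squared norm. Averaging turns the logarithms into the entropy of the transcript, at most
`n k log 2`, which gives `2 n k / σ²` (`fisherTrace_le_log_card`). Hence the trace is at most `2 N`
with `N = n min(k, d) / σ²`.

A multivariate van Trees inequality (`van_trees`) with prior proportional to `∏ cos² (π θ_j / (2B))`
on the cube concludes: the prior information `d π² / B²` is at most `π² N` by the assumption on `B`,
so the risk is at least a constant times `d² / N`. -/

/-- Chain rule for adaptive protocols: only the last factor involves the last message, so it is
summed out first. -/
theorem sum_prod_before_eq_one {A : Type*} [Fintype A] :
    ∀ {N : ℕ} (c : (t : Fin N) → (Fin (t : ℕ) → A) → A → ℝ), (∀ t v, ∑ a, c t v a = 1) →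
      ∑ y : Fin N → A, ∏ t, c t (before y t) (y t) = 1 := by
  intro N
  induction N with
  | zero => intro c _; simp
  | succ N ih =>
    intro c hc
    rw [← (Fin.snocEquiv fun _ : Fin (N + 1) => A).sum_comp, Fintype.sum_prod_type_right]
    rw [← ih (fun t v a => c t.castSucc v a) (fun t v => hc t.castSucc v)]
    refine Finset.sum_congr rfl fun y _ => ?_
    have key : ∀ a : A, ∏ t, c t (before (Fin.snoc (α := fun _ => A) y a) t)
        (Fin.snoc (α := fun _ => A) y a t) =
        (∏ t, c t.castSucc (before y t) (y t)) * c (Fin.last N) y a := by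
      intro a
      rw [Fin.prod_univ_castSucc]
      congr 1
      · refine Finset.prod_congr rfl fun t _ => ?_
        rw [Fin.snoc_castSucc]
        congr 1
        funext s
        exact Fin.snoc_castSucc (α := fun _ => A) a y (s.castLE t.isLt.le)
      · rw [Fin.snoc_last]
        congr 1
        funext s
        exact Fin.snoc_castSucc (α := fun _ => A) a y s
    calc _ = ∑ a, (∏ t, c t.castSucc (before y t) (y t)) * c (Fin.last N) y a :=
          Finset.sum_congr rfl fun a _ => key a
      _ = _ := by rw [← Finset.mul_sum, hc, mul_one]

/-! ### Fisher information of transcripts of product form -/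

section Fisher

variable {n : ℕ} {𝒳 Y : Type*} [MeasurableSpace 𝒳] [Fintype Y]

/-- Conditional transcript probabilities of product form `∏ i, g i (x i) y`. -/
structure IsProductTranscript (g : Fin n → 𝒳 → Y → ℝ) : Prop where
  measurable : ∀ i y, Measurable fun x => g i x y
  nonneg : ∀ i x y, 0 ≤ g i x y
  le_one : ∀ i x y, g i x y ≤ 1
  sum_prod : ∀ x : Fin n → 𝒳, ∑ y, ∏ i, g i (x i) y = 1

variable {g : Fin n → 𝒳 → Y → ℝ}

theorem IsProductTranscript.integrable_mul (hg : IsProductTranscript g) {ν : Measure 𝒳}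
    {c : 𝒳 → ℝ} (hc : Integrable c ν) (i : Fin n) (y : Y) :
    Integrable (fun x => c x * g i x y) ν :=
  hc.mul_bdd (c := 1) (hg.measurable i y).aestronglyMeasurable
    (.of_forall fun x => by
      rw [Real.norm_of_nonneg (hg.nonneg i x y)]; exact hg.le_one i x y)

theorem IsProductTranscript.integrable (hg : IsProductTranscript g) {ν : Measure 𝒳}
    [IsFiniteMeasure ν] (i : Fin n) (y : Y) : Integrable (fun x => g i x y) ν := by
  simpa using hg.integrable_mul (integrable_const (1 : ℝ)) i y

/-- By Fubini, both sides are the expectation of `∏ i, c i (X i)`. Different choices of `c` yield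
all the averages over transcripts needed below. -/
theorem IsProductTranscript.sum_prod_integral_mul (hg : IsProductTranscript g) (ν : Measure 𝒳)
    [IsProbabilityMeasure ν] {c : Fin n → 𝒳 → ℝ} (hc : ∀ i, Integrable (c i) ν) :
    ∑ y, ∏ i, ∫ x, c i x * g i x y ∂ν = ∏ i, ∫ x, c i x ∂ν := by
  have h1 : ∀ y, ∏ i, ∫ x, c i x * g i x y ∂ν =
      ∫ x, ∏ i, (c i (x i) * g i (x i) y) ∂(Measure.pi fun _ : Fin n => ν) := fun y =>
    (integral_fintype_prod_eq_prod (μ := fun _ : Fin n => ν) fun i x => c i x * g i x y).symm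
  simp_rw [h1]
  rw [← integral_finsetSum, ← integral_fintype_prod_eq_prod (μ := fun _ : Fin n => ν)]
  · refine integral_congr_ae (.of_forall fun x => ?_)
    simp only [Finset.prod_mul_distrib]
    rw [← Finset.mul_sum, hg.sum_prod, mul_one]
  · exact fun y _ => Integrable.fintype_prod_dep (μ := fun _ : Fin n => ν)
      (f := fun i x => c i x * g i x y) fun i => hg.integrable_mul (hc i) i y

theorem IsProductTranscript.sum_prod_integral (hg : IsProductTranscript g) (ν : Measure 𝒳)
    [IsProbabilityMeasure ν] : ∑ y, ∏ i, ∫ x, g i x y ∂ν = 1 := by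
  simpa using hg.sum_prod_integral_mul ν (c := fun _ _ => 1) fun _ => integrable_const _

/-- If a nonnegative weight has zero mass, it annihilates all integrals. -/
theorem IsProductTranscript.integral_mul_eq_zero (hg : IsProductTranscript g) {ν : Measure 𝒳}
    [IsFiniteMeasure ν] (c : 𝒳 → ℝ) {i : Fin n} {y : Y} (h : ∫ x, g i x y ∂ν = 0) :
    ∫ x, c x * g i x y ∂ν = 0 := by
  rw [integral_eq_zero_iff_of_nonneg (fun x => hg.nonneg i x y) (hg.integrable i y)] at h
  rw [integral_eq_zero_of_ae]
  filter_upwards [h] with x hx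
  simp only [Pi.zero_apply] at hx ⊢
  rw [hx, mul_zero]

theorem IsProductTranscript.integral_nonneg (hg : IsProductTranscript g) (ν : Measure 𝒳)
    (i : Fin n) (y : Y) : 0 ≤ ∫ x, g i x y ∂ν :=
  MeasureTheory.integral_nonneg fun x => hg.nonneg i x y

/-- A score: square integrable, centred, with second moments `τ` and Gaussian moment generating
function. -/
structure IsGaussianScore {d : ℕ} (ν : Measure 𝒳) (s : Fin d → 𝒳 → ℝ) (τ : ℝ) : Prop where
  memLp : ∀ j, MemLp (s j) 2 ν
  integral_eq_zero : ∀ j, ∫ x, s j x ∂ν = 0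
  integral_sq : ∀ j, ∫ x, s j x ^ 2 ∂ν = τ
  integrable_exp : ∀ u : Fin d → ℝ, Integrable (fun x => Real.exp (∑ j, u j * s j x)) ν
  integral_exp : ∀ u : Fin d → ℝ,
    ∫ x, Real.exp (∑ j, u j * s j x) ∂ν = Real.exp (τ * (∑ j, u j ^ 2) / 2)

/-- The conditional expectation of the function `c` of the `i`-th sample, given the transcript `y`. -/
noncomputable def condMean (ν : Measure 𝒳) (g : Fin n → 𝒳 → Y → ℝ) (c : 𝒳 → ℝ) (i : Fin n)
    (y : Y) : ℝ :=
  (∫ x, c x * g i x y ∂ν) / ∫ x, g i x y ∂ν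

theorem IsProductTranscript.integral_mul_condMean (hg : IsProductTranscript g) (ν : Measure 𝒳)
    [IsFiniteMeasure ν] (c : 𝒳 → ℝ) (i : Fin n) (y : Y) :
    (∫ x, g i x y ∂ν) * condMean ν g c i y = ∫ x, c x * g i x y ∂ν := by
  -- In the degenerate case the quotient takes the value `0`, which is harmless: the weight vanishes
  -- almost everywhere.
  by_cases h : ∫ x, g i x y ∂ν = 0
  · rw [hg.integral_mul_eq_zero c h, h, zero_mul]
  · rw [condMean]; field_simp

/-- Conditional means of centred functions of different samples are uncorrelated. -/
theorem IsProductTranscript.sum_condMean_mul_condMean (hg : IsProductTranscript g) (ν : Measure 𝒳)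
    [IsProbabilityMeasure ν] {c : 𝒳 → ℝ} (hc : Integrable c ν) (h0 : ∫ x, c x ∂ν = 0)
    {i l : Fin n} (hil : i ≠ l) :
    ∑ y, (∏ r, ∫ x, g r x y ∂ν) * (condMean ν g c i y * condMean ν g c l y) = 0 := by
  -- Inserting `c` at the two nodes makes the average equal to a product containing the factor `∫ c
  -- = 0`.
  let e : Fin n → 𝒳 → ℝ := fun r => if r = i ∨ r = l then c else fun _ => 1
  have he : ∀ r, Integrable (e r) ν := fun r => by
    by_cases h : r = i ∨ r = l
    · simpa [e, h] using hc
    · simp [e, h]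
  have := hg.sum_prod_integral_mul ν he
  rw [Finset.prod_eq_zero (Finset.mem_univ i) (by simpa [e] using h0)] at this
  rw [← this]
  refine Finset.sum_congr rfl fun y _ => ?_
  have h2 : ∀ r, ∫ x, e r x * g r x y ∂ν = (∫ x, g r x y ∂ν) *
      (if r = i then condMean ν g c i y else 1) * (if r = l then condMean ν g c l y else 1) := by
    intro r
    by_cases h : r = i
    · subst h
      simp [e, hil, hg.integral_mul_condMean]
    · by_cases h' : r = l
      · subst h'
        simp [e, h, hg.integral_mul_condMean]
      · simp [e, h, h']
  simp_rw [h2, Finset.prod_mul_distrib]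
  rw [Fintype.prod_ite_eq', Fintype.prod_ite_eq', mul_assoc]

theorem IsProductTranscript.sum_sq_sum_condMean (hg : IsProductTranscript g) (ν : Measure 𝒳)
    [IsProbabilityMeasure ν] {c : 𝒳 → ℝ} (hc : Integrable c ν) (h0 : ∫ x, c x ∂ν = 0) :
    ∑ y, (∏ r, ∫ x, g r x y ∂ν) * (∑ i, condMean ν g c i y) ^ 2 =
      ∑ y, (∏ r, ∫ x, g r x y ∂ν) * ∑ i, condMean ν g c i y ^ 2 := by
  have h1 : ∀ y, (∏ r, ∫ x, g r x y ∂ν) * (∑ i, condMean ν g c i y) ^ 2 =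
      ∑ i, ∑ l, (∏ r, ∫ x, g r x y ∂ν) * (condMean ν g c i y * condMean ν g c l y) := fun y => by
    rw [sq, Finset.sum_mul_sum]; simp_rw [Finset.mul_sum]
  simp_rw [h1, Finset.mul_sum]
  rw [Finset.sum_comm]
  rw [Finset.sum_comm (s := Finset.univ (α := Y))]
  refine Finset.sum_congr rfl fun i _ => ?_
  rw [Finset.sum_comm, Finset.sum_eq_single i]
  · simp_rw [← sq]
  · exact fun l _ hl => hg.sum_condMean_mul_condMean ν hc h0 (Ne.symm hl)
  · simp

/-- The conditional variance of `c` is nonnegative. -/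
theorem IsProductTranscript.integral_mul_sq_condMean_le (hg : IsProductTranscript g)
    (ν : Measure 𝒳) [IsProbabilityMeasure ν] {c : 𝒳 → ℝ} (hc : MemLp c 2 ν) (i : Fin n) (y : Y) :
    (∫ x, g i x y ∂ν) * condMean ν g c i y ^ 2 ≤ ∫ x, c x ^ 2 * g i x y ∂ν := by
  set t := condMean ν g c i y with ht
  have hc1 : Integrable c ν := hc.integrable one_le_two
  have h0 : 0 ≤ ∫ x, (c x - t) ^ 2 * g i x y ∂ν :=
    MeasureTheory.integral_nonneg fun x => mul_nonneg (sq_nonneg _) (hg.nonneg i x y)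
  have h1 : ∫ x, (c x - t) ^ 2 * g i x y ∂ν = ∫ x, c x ^ 2 * g i x y ∂ν -
      2 * t * (∫ x, c x * g i x y ∂ν) + t ^ 2 * ∫ x, g i x y ∂ν := by
    rw [← integral_const_mul, ← integral_const_mul, ← integral_sub, ← integral_add]
    · exact integral_congr_ae (.of_forall fun x => by ring)
    · exact (hg.integrable_mul hc.integrable_sq i y).sub
        ((hg.integrable_mul hc1 i y).const_mul _)
    · exact (hg.integrable i y).const_mul _
    · exact hg.integrable_mul hc.integrable_sq i y
    · exact (hg.integrable_mul hc1 i y).const_mul _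
  rw [h1, ← hg.integral_mul_condMean ν c i y, ← ht] at h0
  nlinarith

theorem IsProductTranscript.sum_mul_sq_condMean_le (hg : IsProductTranscript g)
    (ν : Measure 𝒳) [IsProbabilityMeasure ν] {c : 𝒳 → ℝ} (hc : MemLp c 2 ν) (i : Fin n) :
    ∑ y, (∏ r, ∫ x, g r x y ∂ν) * condMean ν g c i y ^ 2 ≤ ∫ x, c x ^ 2 ∂ν := by
  let e : Fin n → 𝒳 → ℝ := fun r => if r = i then fun x => c x ^ 2 else fun _ => 1
  have he : ∀ r, Integrable (e r) ν := fun r => by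
    by_cases h : r = i
    · simpa [e, h] using hc.integrable_sq
    · simp [e, h]
  have h1 := hg.sum_prod_integral_mul ν he
  have h2 : ∏ r, ∫ x, e r x ∂ν = ∫ x, c x ^ 2 ∂ν := by
    rw [Finset.prod_eq_single i]
    · simp [e]
    · intro r _ hr; simp [e, hr]
    · simp
  rw [← h2, ← h1]
  refine Finset.sum_le_sum fun y _ => ?_
  rw [← Finset.mul_prod_erase _ _ (Finset.mem_univ i), ← Finset.mul_prod_erase _ _
    (Finset.mem_univ i), mul_right_comm]
  have h3 : ∏ r ∈ Finset.univ.erase i, ∫ x, e r x * g r x y ∂ν =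
      ∏ r ∈ Finset.univ.erase i, ∫ x, g r x y ∂ν :=
    Finset.prod_congr rfl fun r hr => by simp [e, Finset.ne_of_mem_erase hr]
  rw [h3]
  refine mul_le_mul_of_nonneg_right ?_ (Finset.prod_nonneg fun r _ => hg.integral_nonneg ν r y)
  simpa [e] using hg.integral_mul_sq_condMean_le ν hc i y

/-- A weight bounded by `1` can displace the mean of the score only at an exponential cost in its
mass. Testing it against an exponential tilt gives `exp (Q / τ) * G ≤ exp (Q / (2 * τ))`, with no
dependence on the dimension. -/
theorem IsProductTranscript.sum_sq_condMean_le_neg_log (hg : IsProductTranscript g)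
    {ν : Measure 𝒳} [IsProbabilityMeasure ν] {d : ℕ} {s : Fin d → 𝒳 → ℝ} {τ : ℝ} (hτ : 0 < τ)
    (hs : IsGaussianScore ν s τ) {i : Fin n} {y : Y} (hpos : 0 < ∫ x, g i x y ∂ν) :
    ∑ j, condMean ν g (s j) i y ^ 2 ≤ 2 * τ * -Real.log (∫ x, g i x y ∂ν) := by
  set G := ∫ x, g i x y ∂ν with hG
  set A : Fin d → ℝ := fun j => condMean ν g (s j) i y with hA
  set Q := ∑ j, A j ^ 2 with hQ
  have hs1 : ∀ j, Integrable (s j) ν := fun j => (hs.memLp j).integrable one_le_two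
  -- This tilt maximises `∑ j, u j * A j - τ * (∑ j, u j ^ 2) / 2`.
  set u : Fin d → ℝ := fun j => τ⁻¹ * A j with hu
  set z : 𝒳 → ℝ := fun x => ∑ j, u j * s j x with hz
  have hzi : Integrable z ν := integrable_finsetSum _ fun j _ => (hs1 j).const_mul _
  have hmean : ∫ x, z x * g i x y ∂ν = G * (τ⁻¹ * Q) := by
    simp_rw [hz, Finset.sum_mul]
    rw [integral_finsetSum]
    · simp_rw [mul_assoc]
      simp_rw [integral_const_mul, ← hg.integral_mul_condMean, hQ, Finset.mul_sum]
      refine Finset.sum_congr rfl fun j _ => ?_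
      simp only [hu, hA]; ring
    · exact fun j _ => by
        simpa only [mul_assoc] using (hg.integrable_mul (hs1 j) i y).const_mul (u j)
  -- Tangent line of `exp` at `τ⁻¹ * Q`, the conditional mean of `z`; the linear part then
  -- integrates to zero against `g`. The bound `g ≤ 1` removes the weight on the right.
  have hpt : ∀ x, Real.exp (τ⁻¹ * Q) * ((1 - τ⁻¹ * Q) * g i x y + z x * g i x y) ≤
      Real.exp (z x) := by
    intro x
    have h1 : z x - τ⁻¹ * Q + 1 ≤ Real.exp (z x - τ⁻¹ * Q) := Real.add_one_le_exp _
    have h2 : Real.exp (z x) = Real.exp (τ⁻¹ * Q) * Real.exp (z x - τ⁻¹ * Q) := by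
      rw [← Real.exp_add]; congr 1; ring
    rw [h2]
    refine mul_le_mul_of_nonneg_left ?_ (Real.exp_pos _).le
    calc (1 - τ⁻¹ * Q) * g i x y + z x * g i x y = (z x - τ⁻¹ * Q + 1) * g i x y := by ring
      _ ≤ Real.exp (z x - τ⁻¹ * Q) * g i x y :=
          mul_le_mul_of_nonneg_right h1 (hg.nonneg i x y)
      _ ≤ Real.exp (z x - τ⁻¹ * Q) := mul_le_of_le_one_right (Real.exp_pos _).le (hg.le_one i x y)
  have hint := integral_mono
    (((hg.integrable i y).const_mul (1 - τ⁻¹ * Q)).add (hg.integrable_mul hzi i y)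
      |>.const_mul (Real.exp (τ⁻¹ * Q))) (hs.integrable_exp u) hpt
  rw [hs.integral_exp u] at hint
  simp only [Pi.add_apply] at hint
  rw [integral_const_mul, integral_add ((hg.integrable i y).const_mul _)
    (hg.integrable_mul hzi i y), integral_const_mul, hmean, ← hG] at hint
  have h3 : Real.exp (τ⁻¹ * Q) * ((1 - τ⁻¹ * Q) * G + G * (τ⁻¹ * Q)) =
      Real.exp (τ⁻¹ * Q + Real.log G) := by
    rw [Real.exp_add, Real.exp_log hpos]; ring
  have h4 : τ * (∑ j, u j ^ 2) / 2 = τ⁻¹ * Q / 2 := by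
    simp only [hu, mul_pow, ← Finset.mul_sum, ← hQ]
    field_simp
  rw [h3, h4, Real.exp_le_exp] at hint
  have h5 : τ * (τ⁻¹ * Q) = Q := by field_simp
  nlinarith

/-- The uniform law maximises entropy: apply `log x ≤ x - 1` at `x = 1 / (card Y * p y)`. -/
theorem neg_sum_mul_log_le_log_card [Nonempty Y] {p : Y → ℝ} (h0 : ∀ y, 0 ≤ p y)
    (h1 : ∑ y, p y = 1) : ∑ y, p y * -Real.log (p y) ≤ Real.log (Fintype.card Y) := by
  have hN : (0 : ℝ) < Fintype.card Y := by exact_mod_cast Fintype.card_pos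
  have key : ∀ y, p y * -Real.log (p y) ≤
      p y * Real.log (Fintype.card Y) + ((Fintype.card Y : ℝ)⁻¹ - p y) := by
    intro y
    rcases (h0 y).eq_or_lt with h | h
    · rw [← h]; simp
    · have := Real.log_le_sub_one_of_pos (x := (Fintype.card Y * p y)⁻¹) (by positivity)
      rw [Real.log_inv, Real.log_mul hN.ne' h.ne'] at this
      have h2 : p y * (Fintype.card Y * p y)⁻¹ = (Fintype.card Y : ℝ)⁻¹ := by field_simp
      nlinarith
  refine (Finset.sum_le_sum fun y _ => key y).trans (le_of_eq ?_)
  rw [Finset.sum_add_distrib, ← Finset.sum_mul, h1, Finset.sum_sub_distrib, h1]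
  simp

/-- The trace of the Fisher information of a transcript of product form. -/
noncomputable def fisherTrace {d : ℕ} (ν : Measure 𝒳) (g : Fin n → 𝒳 → Y → ℝ)
    (s : Fin d → 𝒳 → ℝ) : ℝ :=
  ∑ y, (∏ r, ∫ x, g r x y ∂ν) * ∑ j, (∑ i, condMean ν g (s j) i y) ^ 2

theorem IsProductTranscript.fisherTrace_eq (hg : IsProductTranscript g) {ν : Measure 𝒳}
    [IsProbabilityMeasure ν] {d : ℕ} {s : Fin d → 𝒳 → ℝ} {τ : ℝ} (hs : IsGaussianScore ν s τ) :
    fisherTrace ν g s =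
      ∑ j, ∑ y, (∏ r, ∫ x, g r x y ∂ν) * ∑ i, condMean ν g (s j) i y ^ 2 := by
  rw [fisherTrace, Finset.sum_congr rfl fun y _ => Finset.mul_sum _ _ _, Finset.sum_comm]
  exact Finset.sum_congr rfl fun j _ =>
    hg.sum_sq_sum_condMean ν ((hs.memLp j).integrable one_le_two) (hs.integral_eq_zero j)

theorem IsProductTranscript.fisherTrace_le_dim (hg : IsProductTranscript g) {ν : Measure 𝒳}
    [IsProbabilityMeasure ν] {d : ℕ} {s : Fin d → 𝒳 → ℝ} {τ : ℝ} (hs : IsGaussianScore ν s τ) :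
    fisherTrace ν g s ≤ d * n * τ := by
  rw [hg.fisherTrace_eq hs]
  have : ∀ j, ∑ y, (∏ r, ∫ x, g r x y ∂ν) * ∑ i, condMean ν g (s j) i y ^ 2 ≤ n * τ := by
    intro j
    simp_rw [Finset.mul_sum]
    rw [Finset.sum_comm]
    refine (Finset.sum_le_sum fun i _ => hg.sum_mul_sq_condMean_le ν (hs.memLp j) i).trans ?_
    simp [hs.integral_sq]
  refine (Finset.sum_le_sum fun j _ => this j).trans ?_
  simp [mul_assoc]

theorem IsProductTranscript.fisherTrace_le_log_card (hg : IsProductTranscript g) {ν : Measure 𝒳}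
    [IsProbabilityMeasure ν] {d : ℕ} {s : Fin d → 𝒳 → ℝ} {τ : ℝ} (hτ : 0 < τ)
    (hs : IsGaussianScore ν s τ) : fisherTrace ν g s ≤ 2 * τ * Real.log (Fintype.card Y) := by
  have hsum := hg.sum_prod_integral ν
  have hP : ∀ y, 0 ≤ ∏ r, ∫ x, g r x y ∂ν := fun y =>
    Finset.prod_nonneg fun r _ => hg.integral_nonneg ν r y
  have hne : Nonempty Y := by
    by_contra h
    rw [not_nonempty_iff] at h
    simp at hsum
  rw [hg.fisherTrace_eq hs, Finset.sum_comm]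
  refine le_trans (Finset.sum_le_sum fun y _ => ?_) ((Finset.mul_sum _ _ _).symm.trans_le
    (mul_le_mul_of_nonneg_left (neg_sum_mul_log_le_log_card hP hsum) (by positivity)))
  rw [← Finset.mul_sum, Finset.sum_comm]
  rcases (hP y).eq_or_lt with h | h
  · rw [← h]; simp
  · have hpos : ∀ i, 0 < ∫ x, g i x y ∂ν := fun i =>
      (hg.integral_nonneg ν i y).lt_of_ne fun h' =>
        h.ne' (Finset.prod_eq_zero (Finset.mem_univ i) h'.symm)
    rw [mul_left_comm]
    refine mul_le_mul_of_nonneg_left ?_ h.le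
    -- The product form splits `-log P(y)` into one cost per node, matching the bound for each node.
    rw [Real.log_prod (fun i _ => (hpos i).ne'), ← Finset.sum_neg_distrib, Finset.mul_sum]
    exact Finset.sum_le_sum fun i _ => hg.sum_sq_condMean_le_neg_log hτ hs (hpos i)

end Fisher

/-! ### Van Trees inequality on a cube with a squared cosine prior -/

open Set in
/-- Divergence theorem on the box `[-B, B]^(m+1)` for a vector field which is tangent to the
boundary. -/
theorem setIntegral_divergence_eq_zero {m : ℕ} {B : ℝ} (hB : 0 ≤ B)
    {V D : Fin (m + 1) → (Fin (m + 1) → ℝ) → ℝ} (hV : ∀ j, Differentiable ℝ (V j))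
    (hD : ∀ j, Continuous (D j))
    (hVD : ∀ j θ, HasDerivAt (fun t => V j (Function.update θ j t)) (D j θ) (θ j))
    (h0 : ∀ j θ, θ j = B ∨ θ j = -B → V j θ = 0) :
    ∫ θ in Icc (fun _ => -B) (fun _ => B), ∑ j, D j θ = 0 := by
  have hfd : ∀ j θ, fderiv ℝ (V j) θ (Pi.single j 1) = D j θ := by
    intro j θ
    have h1 : HasFDerivAt (V j) (fderiv ℝ (V j) θ) (Function.update θ j (θ j)) := by
      rw [Function.update_eq_self]; exact (hV j θ).hasFDerivAt
    exact (h1.comp_hasDerivAt (θ j) (hasDerivAt_update θ j (θ j))).unique (hVD j θ)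
  have := integral_divergence_of_hasFDerivAt_off_countable' (fun _ : Fin (m + 1) => -B)
    (fun _ => B) (fun _ => by simp only; linarith) V (fun j θ => fderiv ℝ (V j) θ) ∅
    countable_empty (fun j => (hV j).continuous.continuousOn)
    (fun θ _ j => (hV j θ).hasFDerivAt)
    (by
      simp_rw [hfd]
      exact (continuous_finsetSum _ fun j _ => hD j).continuousOn.integrableOn_compact
        isCompact_Icc)
  simp_rw [hfd] at this
  rw [this]
  refine Finset.sum_eq_zero fun j _ => ?_
  rw [integral_eq_zero_of_ae (.of_forall fun x => h0 j _ (by simp)),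
    integral_eq_zero_of_ae (.of_forall fun x => h0 j _ (by simp)), sub_zero]

section CosProd

variable {ι : Type*} [Fintype ι] [DecidableEq ι]

/-- The first Dirichlet eigenfunction of a cube. -/
noncomputable def cosProd (ω : ℝ) (θ : ι → ℝ) : ℝ := ∏ l, Real.cos (ω * θ l)

/-- The partial derivatives of `cosProd`. -/
noncomputable def cosProdDeriv (ω : ℝ) (j : ι) (θ : ι → ℝ) : ℝ :=
  -(ω * Real.sin (ω * θ j)) * ∏ l ∈ Finset.univ.erase j, Real.cos (ω * θ l)

omit [DecidableEq ι] in
theorem differentiable_cosProd (ω : ℝ) : Differentiable ℝ (cosProd ω : (ι → ℝ) → ℝ) := by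
  unfold cosProd
  fun_prop

theorem differentiable_cosProdDeriv (ω : ℝ) (j : ι) :
    Differentiable ℝ (cosProdDeriv ω j : (ι → ℝ) → ℝ) := by
  unfold cosProdDeriv
  fun_prop

theorem prod_erase_cos_update (ω : ℝ) (j : ι) (θ : ι → ℝ) (t : ℝ) :
    ∏ l ∈ Finset.univ.erase j, Real.cos (ω * Function.update θ j t l) =
      ∏ l ∈ Finset.univ.erase j, Real.cos (ω * θ l) :=
  Finset.prod_congr rfl fun l hl => by rw [Function.update_of_ne (Finset.ne_of_mem_erase hl)]

theorem hasDerivAt_cosProd_update (ω : ℝ) (j : ι) (θ : ι → ℝ) :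
    HasDerivAt (fun t => cosProd ω (Function.update θ j t)) (cosProdDeriv ω j θ) (θ j) := by
  have h : ∀ t, cosProd ω (Function.update θ j t) =
      Real.cos (ω * t) * ∏ l ∈ Finset.univ.erase j, Real.cos (ω * θ l) := fun t => by
    rw [cosProd, ← Finset.mul_prod_erase _ _ (Finset.mem_univ j), prod_erase_cos_update]
    simp
  simp_rw [h]
  convert! (((hasDerivAt_id (θ j)).const_mul ω).cos).mul_const _ using 1
  simp [cosProdDeriv]; left; ring

theorem hasDerivAt_cosProdDeriv_update (ω : ℝ) (j : ι) (θ : ι → ℝ) :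
    HasDerivAt (fun t => cosProdDeriv ω j (Function.update θ j t)) (-ω ^ 2 * cosProd ω θ)
      (θ j) := by
  have h : ∀ t, cosProdDeriv ω j (Function.update θ j t) =
      -(ω * Real.sin (ω * t)) * ∏ l ∈ Finset.univ.erase j, Real.cos (ω * θ l) := fun t => by
    rw [cosProdDeriv, prod_erase_cos_update]
    simp
  simp_rw [h]
  convert! (((((hasDerivAt_id (θ j)).const_mul ω).sin).const_mul ω).neg).mul_const _ using 1
  rw [cosProd, ← Finset.mul_prod_erase _ _ (Finset.mem_univ j)]
  simp; ring

omit [DecidableEq ι] in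
theorem cosProd_eq_zero {B : ℝ} (hB : 0 < B) {θ : ι → ℝ} {j : ι} (h : θ j = B ∨ θ j = -B) :
    cosProd (Real.pi / (2 * B)) θ = 0 := by
  refine Finset.prod_eq_zero (Finset.mem_univ j) ?_
  -- This frequency puts the first zeros of the cosine exactly on the faces of the cube.
  have h1 : Real.pi / (2 * B) * B = Real.pi / 2 := by field_simp
  rcases h with h | h
  · rw [h, h1, Real.cos_pi_div_two]
  · rw [h, mul_neg, h1, Real.cos_neg, Real.cos_pi_div_two]

open Set in
omit [DecidableEq ι] in
theorem setIntegral_cosProd_sq_pos {B : ℝ} (hB : 0 < B) (ω : ℝ) :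
    0 < ∫ θ in Icc (fun _ : ι => -B) (fun _ => B), cosProd ω θ ^ 2 := by
  have hc : Continuous fun θ : ι → ℝ => cosProd ω θ ^ 2 :=
    (differentiable_cosProd ω).continuous.pow 2
  have hint : IntegrableOn (fun θ : ι → ℝ => cosProd ω θ ^ 2) (Icc (fun _ => -B) (fun _ => B)) :=
    hc.continuousOn.integrableOn_compact isCompact_Icc
  rw [setIntegral_pos_iff_support_of_nonneg_ae (.of_forall fun θ => sq_nonneg _) hint]
  have hU : IsOpen (Function.support (fun θ : ι → ℝ => cosProd ω θ ^ 2) ∩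
      Set.pi univ fun _ => Ioo (-B) B) :=
    hc.isOpen_support.inter (isOpen_set_pi finite_univ fun _ _ => isOpen_Ioo)
  refine (hU.measure_pos volume ⟨0, ?_, fun i _ => ?_⟩).trans_le (measure_mono ?_)
  · simp [cosProd]
  · simpa using hB
  · refine inter_subset_inter_right _ fun θ h => ⟨fun i => (h i trivial).1.le,
      fun i => (h i trivial).2.le⟩

end CosProd

open Set in
/-- A multivariate van Trees inequality for finite families of likelihoods `P y θ`, with scores
`S y j θ`. -/
theorem van_trees {m : ℕ} {Y : Type*} [Fintype Y] {B R F l : ℝ} (hB : 0 < B) (hl : 0 < l)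
    {P : Y → (Fin (m + 1) → ℝ) → ℝ} {S P' : Y → Fin (m + 1) → (Fin (m + 1) → ℝ) → ℝ}
    (e : Y → Fin (m + 1) → ℝ) (hP0 : ∀ y θ, 0 ≤ P y θ) (hP1 : ∀ θ, ∑ y, P y θ = 1)
    (hP : ∀ y, Differentiable ℝ (P y)) (hP'c : ∀ y j, Continuous (P' y j))
    (hPP' : ∀ y j θ, HasDerivAt (fun t => P y (Function.update θ j t)) (P' y j θ) (θ j))
    (hS : ∀ y j θ, P' y j θ = P y θ * S y j θ)
    (hF : ∀ θ ∈ Icc (fun _ => -B) (fun _ => B), ∑ y, P y θ * ∑ j, S y j θ ^ 2 ≤ F)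
    (hR : ∀ θ ∈ Icc (fun _ => -B) (fun _ => B), ∑ y, P y θ * ∑ j, (e y j - θ j) ^ 2 ≤ R) :
    ((m + 1 : ℕ) : ℝ) ≤ l * R + F / (2 * l) + 2 / l * ((m + 1 : ℕ) : ℝ) *
      (Real.pi / (2 * B)) ^ 2 := by
  set ω := Real.pi / (2 * B) with hω
  set h : (Fin (m + 1) → ℝ) → ℝ := cosProd ω with hh
  set q : Fin (m + 1) → (Fin (m + 1) → ℝ) → ℝ := cosProdDeriv ω with hq
  have hhd : Differentiable ℝ h := differentiable_cosProd ω
  have hqd : ∀ j, Differentiable ℝ (q j) := differentiable_cosProdDeriv ω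
  have hhc := hhd.continuous
  have hqc := fun j => (hqd j).continuous
  have hPc := fun y => (hP y).continuous
  -- The first term is the usual van Trees integration by parts with unnormalised prior `h ^ 2`. The
  -- added gradient term has divergence `2 / l * (|∇h|² - (m + 1) * ω ^ 2 * h ^ 2)`: its positive
  -- part absorbs the cross term between the error and `∇h`, its negative part is the cost of the
  -- prior. Both terms vanish on the faces.
  let V : Fin (m + 1) → (Fin (m + 1) → ℝ) → ℝ := fun j θ =>
    ∑ y, (θ j - e y j) * P y θ * h θ ^ 2 + 2 / l * (h θ * q j θ)
  let D : Fin (m + 1) → (Fin (m + 1) → ℝ) → ℝ := fun j θ =>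
    ∑ y, ((P y θ + (θ j - e y j) * P' y j θ) * h θ ^ 2 +
      (θ j - e y j) * P y θ * (2 * h θ * q j θ)) + 2 / l * (q j θ ^ 2 - ω ^ 2 * h θ ^ 2)
  have hVd : ∀ j, Differentiable ℝ (V j) := fun j => by
    simp only [V]
    fun_prop
  have hDc : ∀ j, Continuous (D j) := fun j => by
    simp only [D]
    fun_prop
  have hVD : ∀ j θ, HasDerivAt (fun t => V j (Function.update θ j t)) (D j θ) (θ j) := by
    intro j θ
    have h1 := hasDerivAt_cosProd_update ω j θ
    have h2 := hasDerivAt_cosProdDeriv_update ω j θ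
    have h3 : ∀ y, HasDerivAt (fun t => (Function.update θ j t j - e y j)) 1 (θ j) := fun y => by
      simpa using (hasDerivAt_id (θ j)).sub_const (e y j)
    simp only [V, D]
    convert! (HasDerivAt.fun_sum fun y _ => ((h3 y).fun_mul (hPP' y j θ)).fun_mul
      (h1.fun_pow 2)).fun_add ((h1.fun_mul h2).const_mul (2 / l)) using 1
    simp only [Function.update_eq_self, ← hh, ← hq]
    congr 1
    · refine Finset.sum_congr rfl fun y _ => ?_
      push_cast; ring
    · ring
  have hV0 : ∀ j θ, θ j = B ∨ θ j = -B → V j θ = 0 := by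
    intro j θ hj
    have : h θ = 0 := cosProd_eq_zero hB hj
    simp [V, this]
  have hdiv := setIntegral_divergence_eq_zero hB.le hVd hDc hVD hV0
  set K : ℝ := ((m + 1 : ℕ) : ℝ) - l * R - F / (2 * l) - 2 / l * ((m + 1 : ℕ) : ℝ) * ω ^ 2 with hK
  have hpt : ∀ θ ∈ Icc (fun _ => -B) (fun _ => B), K * h θ ^ 2 ≤ ∑ j, D j θ := by
    intro θ hθ
    have hsum : ∑ j, D j θ = ∑ y, P y θ * ∑ j, (h θ ^ 2 + ((θ j - e y j) * S y j θ * h θ ^ 2 +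
        (θ j - e y j) * (2 * h θ * q j θ) + 2 / l * q j θ ^ 2)) -
        2 / l * ((m + 1 : ℕ) : ℝ) * ω ^ 2 * h θ ^ 2 := by
      simp only [D]
      rw [Finset.sum_add_distrib, Finset.sum_comm]
      have h1 : ∑ j, 2 / l * (q j θ ^ 2 - ω ^ 2 * h θ ^ 2) =
          ∑ y, P y θ * ∑ j, 2 / l * q j θ ^ 2 - 2 / l * ((m + 1 : ℕ) : ℝ) * ω ^ 2 * h θ ^ 2 := by
        rw [← Finset.sum_mul, hP1, one_mul]
        simp_rw [mul_sub]
        rw [Finset.sum_sub_distrib]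
        simp; ring
      rw [h1, add_sub_assoc', ← Finset.sum_add_distrib]
      congr 1
      refine Finset.sum_congr rfl fun y _ => ?_
      simp_rw [Finset.mul_sum]
      rw [← Finset.sum_add_distrib]
      refine Finset.sum_congr rfl fun j _ => ?_
      rw [hS]; ring
    have hle : ∀ y, P y θ * (((m + 1 : ℕ) : ℝ) * h θ ^ 2 - (l * (∑ j, (e y j - θ j) ^ 2) +
        (∑ j, S y j θ ^ 2) / (2 * l)) * h θ ^ 2) ≤
        P y θ * ∑ j, (h θ ^ 2 + ((θ j - e y j) * S y j θ * h θ ^ 2 +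
        (θ j - e y j) * (2 * h θ * q j θ) + 2 / l * q j θ ^ 2)) := by
      intro y
      refine mul_le_mul_of_nonneg_left ?_ (hP0 y θ)
      have h1 : ((m + 1 : ℕ) : ℝ) * h θ ^ 2 - (l * (∑ j, (e y j - θ j) ^ 2) +
        (∑ j, S y j θ ^ 2) / (2 * l)) * h θ ^ 2 = ∑ j, (h θ ^ 2 - (l * (e y j - θ j) ^ 2 +
          S y j θ ^ 2 / (2 * l)) * h θ ^ 2) := by
        rw [Finset.sum_sub_distrib, ← Finset.sum_mul, Finset.sum_add_distrib, ← Finset.mul_sum,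
          ← Finset.sum_div]
        simp
      rw [h1]
      refine Finset.sum_le_sum fun j _ => ?_
      -- Two completed squares, each using half of `l * (e y j - θ j) ^ 2`: one for the score, one
      -- for the derivative of the prior.
      have h2 : 0 ≤ 1 / (2 * l) * ((l * (e y j - θ j) - S y j θ) * h θ) ^ 2 := by positivity
      have h3 : 0 ≤ 1 / (2 * l) * (l * (e y j - θ j) * h θ - 2 * q j θ) ^ 2 := by positivity
      have h4 : (h θ ^ 2 + ((θ j - e y j) * S y j θ * h θ ^ 2 +
          (θ j - e y j) * (2 * h θ * q j θ) + 2 / l * q j θ ^ 2)) -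
          (h θ ^ 2 - (l * (e y j - θ j) ^ 2 + S y j θ ^ 2 / (2 * l)) * h θ ^ 2) =
          1 / (2 * l) * ((l * (e y j - θ j) - S y j θ) * h θ) ^ 2 +
          1 / (2 * l) * (l * (e y j - θ j) * h θ - 2 * q j θ) ^ 2 := by
        field_simp; ring
      linarith
    have hsum2 : ∑ y, P y θ * (((m + 1 : ℕ) : ℝ) * h θ ^ 2 - (l * (∑ j, (e y j - θ j) ^ 2) +
        (∑ j, S y j θ ^ 2) / (2 * l)) * h θ ^ 2) = ((m + 1 : ℕ) : ℝ) * h θ ^ 2 -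
        (l * (∑ y, P y θ * ∑ j, (e y j - θ j) ^ 2) + (∑ y, P y θ * ∑ j, S y j θ ^ 2) / (2 * l)) *
          h θ ^ 2 := by
      have h1 : ∀ y, P y θ * (((m + 1 : ℕ) : ℝ) * h θ ^ 2 - (l * (∑ j, (e y j - θ j) ^ 2) +
        (∑ j, S y j θ ^ 2) / (2 * l)) * h θ ^ 2) = P y θ * (((m + 1 : ℕ) : ℝ) * h θ ^ 2) -
          (l * (P y θ * ∑ j, (e y j - θ j) ^ 2) +
            (P y θ * ∑ j, S y j θ ^ 2) / (2 * l)) * h θ ^ 2 := fun y => by ring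
      simp_rw [h1]
      rw [Finset.sum_sub_distrib, ← Finset.sum_mul, ← Finset.sum_mul, hP1, one_mul,
        Finset.sum_add_distrib, ← Finset.mul_sum, ← Finset.sum_div]
    have h5 : l * (∑ y, P y θ * ∑ j, (e y j - θ j) ^ 2) +
        (∑ y, P y θ * ∑ j, S y j θ ^ 2) / (2 * l) ≤ l * R + F / (2 * l) := by
      gcongr
      · exact hR θ hθ
      · exact hF θ hθ
    have h6 := mul_le_mul_of_nonneg_right h5 (sq_nonneg (h θ))
    have h7 := Finset.sum_le_sum fun y (_ : y ∈ Finset.univ) => hle y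
    rw [hsum2] at h7
    rw [hsum]
    simp only [hK]
    linarith
  have hmono : ∫ θ in Icc (fun _ : Fin (m + 1) => -B) (fun _ => B), K * h θ ^ 2 ≤
      ∫ θ in Icc (fun _ => -B) (fun _ => B), ∑ j, D j θ :=
    setIntegral_mono_on
      ((continuous_const.mul (hhc.pow 2)).continuousOn.integrableOn_compact isCompact_Icc)
      ((continuous_finsetSum _ fun j _ => hDc j).continuousOn.integrableOn_compact isCompact_Icc)
      measurableSet_Icc hpt
  rw [hdiv, integral_const_mul] at hmono
  have hpos := setIntegral_cosProd_sq_pos (ι := Fin (m + 1)) hB ω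
  -- The divergence integrates to zero while `h ^ 2` has positive mass, so the prior need not be
  -- normalised.
  have : K ≤ 0 := by
    by_contra hc
    exact absurd (mul_pos (not_le.mp hc) hpos) (not_lt.mpr hmono)
  linarith

/-! ### Differentiation of Laplace transforms of Gaussian measures -/

section Laplace

variable {E : Type*} [NormedAddCommGroup E] [InnerProductSpace ℝ E] [FiniteDimensional ℝ E]
  [MeasurableSpace E] [BorelSpace E]

/-- Fernique's theorem makes some `exp (C * ‖x‖ ^ 2)` integrable, and completing the square
dominates any `exp (r * ‖x‖)`. -/
theorem integrable_exp_mul_norm_of_isGaussian (ν : Measure E) [IsGaussian ν] (r : ℝ) :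
    Integrable (fun x => Real.exp (r * ‖x‖)) ν := by
  have : CompleteSpace E := FiniteDimensional.complete ℝ E
  obtain ⟨C, hC, hint⟩ := IsGaussian.exists_integrable_exp_sq ν
  refine (hint.const_mul (Real.exp (r ^ 2 / (4 * C)))).mono'
    (Measurable.aestronglyMeasurable (by fun_prop)) (.of_forall fun x => ?_)
  rw [Real.norm_of_nonneg (Real.exp_pos _).le, ← Real.exp_add, Real.exp_le_exp]
  have h : r ^ 2 / (4 * C) + C * ‖x‖ ^ 2 - r * ‖x‖ = C * (‖x‖ - r / (2 * C)) ^ 2 := by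
    field_simp; ring
  have h2 : 0 ≤ C * (‖x‖ - r / (2 * C)) ^ 2 := by positivity
  linarith

/-- Measurable functions of at most exponential growth. -/
structure IsExpBounded (f : E → ℝ) : Prop where
  measurable : Measurable f
  bound : ∃ c, ∀ x, |f x| ≤ Real.exp (c * ‖x‖)

omit [InnerProductSpace ℝ E] [FiniteDimensional ℝ E] [BorelSpace E] in
theorem IsExpBounded.mul {f f' : E → ℝ} (hf : IsExpBounded f) (hf' : IsExpBounded f') :
    IsExpBounded fun x => f x * f' x := by
  obtain ⟨c, hc⟩ := hf.bound
  obtain ⟨c', hc'⟩ := hf'.bound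
  refine ⟨hf.measurable.mul hf'.measurable, c + c', fun x => ?_⟩
  rw [abs_mul, add_mul, Real.exp_add]
  exact mul_le_mul (hc x) (hc' x) (abs_nonneg _) (Real.exp_pos _).le

theorem isExpBounded_inner (v : E) : IsExpBounded fun x => inner ℝ x v := by
  refine ⟨by fun_prop, ‖v‖, fun x => (abs_real_inner_le_norm x v).trans ?_⟩
  have := Real.add_one_le_exp (‖v‖ * ‖x‖)
  linarith [mul_comm ‖x‖ ‖v‖]

theorem isExpBounded_exp_inner (v : E) : IsExpBounded fun x => Real.exp (inner ℝ v x) := by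
  refine ⟨by fun_prop, ‖v‖, fun x => ?_⟩
  rw [abs_of_pos (Real.exp_pos _), Real.exp_le_exp]
  exact real_inner_le_norm v x

theorem IsExpBounded.integrable {f : E → ℝ} (hf : IsExpBounded f) (ν : Measure E) [IsGaussian ν] :
    Integrable f ν := by
  obtain ⟨c, hc⟩ := hf.bound
  exact (integrable_exp_mul_norm_of_isGaussian ν c).mono' hf.measurable.aestronglyMeasurable
    (.of_forall hc)

/-- The Laplace transform of the signed measure with density `f`. -/
noncomputable def laplace (ν : Measure E) (f : E → ℝ) (θ : E) : ℝ :=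
  ∫ x, f x * Real.exp (inner ℝ θ x) ∂ν

theorem IsExpBounded.exists_hasFDerivAt_laplace {f : E → ℝ} (hf : IsExpBounded f) (ν : Measure E)
    [IsGaussian ν] (θ : E) :
    ∃ L : E →L[ℝ] ℝ, HasFDerivAt (laplace ν f) L θ ∧
      ∀ v, L v = laplace ν (fun x => f x * inner ℝ x v) θ := by
  obtain ⟨c, hc⟩ := hf.bound
  have hF : ∀ θ : E, IsExpBounded fun x => f x * Real.exp (inner ℝ θ x) := fun θ =>
    hf.mul (isExpBounded_exp_inner θ)
  have hmeas : ∀ θ : E, Measurable fun x => (f x * Real.exp (inner ℝ θ x)) • innerSL ℝ x :=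
    fun θ => (hF θ).measurable.smul (innerSL ℝ).continuous.measurable
  -- In the `2`, one unit comes from the radius of the ball and one from `‖x‖ ≤ exp ‖x‖`.
  have hbound : ∀ x, ∀ η ∈ Metric.ball θ 1, ‖(f x * Real.exp (inner ℝ η x)) • innerSL ℝ x‖ ≤
      Real.exp ((c + ‖θ‖ + 2) * ‖x‖) := by
    intro x η hη
    rw [norm_smul, innerSL_apply_norm, norm_mul, Real.norm_eq_abs, Real.norm_eq_abs,
      abs_of_pos (Real.exp_pos _)]
    have h1 : inner ℝ η x ≤ (‖θ‖ + 1) * ‖x‖ := (real_inner_le_norm η x).trans <|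
      mul_le_mul_of_nonneg_right (by
        have := norm_sub_norm_le η θ
        rw [mem_ball_iff_norm] at hη
        linarith) (norm_nonneg x)
    have h2 : ‖x‖ ≤ Real.exp ‖x‖ := by linarith [Real.add_one_le_exp ‖x‖]
    calc |f x| * Real.exp (inner ℝ η x) * ‖x‖
        ≤ Real.exp (c * ‖x‖) * Real.exp ((‖θ‖ + 1) * ‖x‖) * Real.exp ‖x‖ := by
          gcongr
          exact hc x
      _ = Real.exp ((c + ‖θ‖ + 2) * ‖x‖) := by
          rw [← Real.exp_add, ← Real.exp_add]; congr 1; ring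
  have hbi := integrable_exp_mul_norm_of_isGaussian ν (c + ‖θ‖ + 2)
  refine ⟨∫ x, (f x * Real.exp (inner ℝ θ x)) • innerSL ℝ x ∂ν, ?_, fun v => ?_⟩
  · refine hasFDerivAt_integral_of_dominated_of_fderiv_le
      (F' := fun θ x => (f x * Real.exp (inner ℝ θ x)) • innerSL ℝ x)
      (Metric.ball_mem_nhds θ one_pos)
      (.of_forall fun η => (hF η).measurable.aestronglyMeasurable) ((hF θ).integrable ν)
      (hmeas θ).aestronglyMeasurable (.of_forall hbound) hbi (.of_forall fun x η _ => ?_)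
    have h1 : HasFDerivAt (fun η : E => inner ℝ η x) (innerSL ℝ x) η := by
      simp_rw [fun η : E => real_inner_comm x η]
      exact (innerSL ℝ x).hasFDerivAt
    rw [mul_smul]
    exact h1.exp.const_mul (f x)
  · have hint : Integrable (fun x => (f x * Real.exp (inner ℝ θ x)) • innerSL ℝ x) ν :=
      hbi.mono' (hmeas θ).aestronglyMeasurable
        (.of_forall fun x => hbound x θ (Metric.mem_ball_self one_pos))
    rw [ContinuousLinearMap.integral_apply hint]
    refine integral_congr_ae (.of_forall fun x => ?_)
    simp; ring

theorem IsExpBounded.differentiable_laplace {f : E → ℝ} (hf : IsExpBounded f) (ν : Measure E)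
    [IsGaussian ν] : Differentiable ℝ (laplace ν f) := fun θ =>
  let ⟨_, h, _⟩ := hf.exists_hasFDerivAt_laplace ν θ
  h.differentiableAt

end Laplace

/-! ### Likelihood and score of the Gaussian location model -/

section GaussianLocation

variable {d : ℕ} {σ : ℝ}

instance (θ : EuclideanSpace ℝ (Fin d)) : IsGaussian (gaussianLocation d σ θ) := by
  unfold gaussianLocation; infer_instance

theorem posSemidef_sq_smul_one (d : ℕ) (σ : ℝ) :
    (σ ^ 2 • (1 : Matrix (Fin d) (Fin d) ℝ)).PosSemidef :=
  Matrix.PosSemidef.one.smul (sq_nonneg σ)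

theorem charFun_gaussianLocation (θ t : EuclideanSpace ℝ (Fin d)) :
    charFun (gaussianLocation d σ θ) t =
      ∏ j, Complex.exp (t j * θ j * Complex.I - σ ^ 2 * t j ^ 2 / 2) := by
  rw [gaussianLocation, charFun_multivariateGaussian (posSemidef_sq_smul_one d σ),
    ← Complex.exp_sum]
  congr 1
  rw [Finset.sum_sub_distrib, ← Finset.sum_mul, ← Finset.sum_div, Matrix.smul_mulVec,
    Matrix.one_mulVec, dotProduct, PiLp.inner_apply]
  simp only [RCLike.inner_apply, conj_trivial, Pi.smul_apply, smul_eq_mul]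
  push_cast
  congr 2
  · congr 1; funext j; ring
  · exact Finset.sum_congr rfl fun j _ => by ring

theorem gaussianLocation_zero_eq_map_pi :
    gaussianLocation d σ 0 = (Measure.pi fun _ : Fin d =>
      gaussianReal 0 (σ ^ 2).toNNReal).map (WithLp.toLp 2) := by
  have : IsFiniteMeasure ((Measure.pi fun _ : Fin d =>
      gaussianReal 0 (σ ^ 2).toNNReal).map (WithLp.toLp 2)) :=
    Measure.isFiniteMeasure_map _ _
  refine Measure.ext_of_charFun ?_
  ext t
  rw [charFun_gaussianLocation, charFun_pi]
  refine Finset.prod_congr rfl fun j _ => ?_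
  rw [charFun_gaussianReal]
  congr 1
  simp [Real.coe_toNNReal _ (sq_nonneg σ)]

/-- The density of `N(θ, σ² I)` with respect to `N(0, σ² I)`. -/
noncomputable def gaussianLikelihood (σ : ℝ) (θ x : EuclideanSpace ℝ (Fin d)) : ℝ :=
  Real.exp (-‖θ‖ ^ 2 / (2 * σ ^ 2)) * Real.exp (inner ℝ ((σ ^ 2)⁻¹ • θ) x)

theorem measurable_gaussianLikelihood (σ : ℝ) (θ : EuclideanSpace ℝ (Fin d)) :
    Measurable (gaussianLikelihood σ θ) := by
  unfold gaussianLikelihood; fun_prop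

theorem gaussianLikelihood_nonneg (σ : ℝ) (θ x : EuclideanSpace ℝ (Fin d)) :
    0 ≤ gaussianLikelihood σ θ x := by
  unfold gaussianLikelihood; positivity

/-- Both characteristic functions factor over coordinates; each factor on the right is a
one-dimensional Gaussian transform at the complex point `θ j / σ ^ 2 + i * t j`. -/
theorem gaussianLocation_eq_withDensity (hσ : 0 < σ) (θ : EuclideanSpace ℝ (Fin d)) :
    gaussianLocation d σ θ = (gaussianLocation d σ 0).withDensity
      fun x => ENNReal.ofReal (gaussianLikelihood σ θ x) := by
  have hint : Integrable (gaussianLikelihood σ θ) (gaussianLocation d σ 0) :=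
    ((isExpBounded_exp_inner _).integrable _).const_mul _
  have : IsFiniteMeasure ((gaussianLocation d σ 0).withDensity
      fun x => ENNReal.ofReal (gaussianLikelihood σ θ x)) :=
    isFiniteMeasure_withDensity_ofReal hint.2
  refine Measure.ext_of_charFun ?_
  ext t
  rw [charFun_gaussianLocation, charFun_apply, integral_withDensity_eq_integral_toReal_smul
    (measurable_gaussianLikelihood σ θ).ennreal_ofReal (.of_forall fun _ => ENNReal.ofReal_lt_top),
    gaussianLocation_zero_eq_map_pi, integral_map (by fun_prop)]
  · have hpt : ∀ x : Fin d → ℝ, (ENNReal.ofReal (gaussianLikelihood σ θ (WithLp.toLp 2 x))).toReal •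
        Complex.exp (((inner ℝ (WithLp.toLp 2 x) t : ℝ) : ℂ) * Complex.I) =
        ∏ j, (Complex.exp (-θ j ^ 2 / (2 * σ ^ 2)) *
          Complex.exp (((σ ^ 2 : ℝ)⁻¹ * θ j + t j * Complex.I) * id (x j))) := by
      intro x
      rw [ENNReal.toReal_ofReal (gaussianLikelihood_nonneg _ _ _), gaussianLikelihood,
        Complex.real_smul]
      have hn : (‖θ‖ : ℂ) ^ 2 = ∑ j, (θ j : ℂ) ^ 2 := by
        exact_mod_cast EuclideanSpace.real_norm_sq_eq θ
      push_cast
      simp_rw [← Complex.exp_add]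
      rw [← Complex.exp_sum]
      congr 1
      rw [hn]
      simp only [PiLp.inner_apply, RCLike.inner_apply, conj_trivial, PiLp.smul_apply, smul_eq_mul]
      push_cast
      rw [neg_div, Finset.sum_div, ← Finset.sum_neg_distrib, ← Finset.sum_add_distrib,
        Finset.sum_mul, ← Finset.sum_add_distrib]
      refine Finset.sum_congr rfl fun j _ => ?_
      simp only [id]
      ring
    simp_rw [hpt]
    rw [integral_fintype_prod_eq_prod (fun j (x : ℝ) => Complex.exp (-θ j ^ 2 / (2 * σ ^ 2)) *
          Complex.exp (((σ ^ 2 : ℝ)⁻¹ * θ j + t j * Complex.I) * id x))]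
    refine Finset.prod_congr rfl fun j _ => ?_
    rw [integral_const_mul]
    have := complexMGF_id_gaussianReal (μ := 0) (v := (σ ^ 2).toNNReal)
      ((σ ^ 2 : ℝ)⁻¹ * θ j + t j * Complex.I)
    rw [complexMGF] at this
    rw [this, ← Complex.exp_add]
    congr 1
    have hσ' : (σ : ℂ) ≠ 0 := by exact_mod_cast hσ.ne'
    have hv : ((((σ ^ 2).toNNReal : NNReal) : ℝ) : ℂ) = (σ : ℂ) ^ 2 := by
      rw [Real.coe_toNNReal _ (sq_nonneg σ)]; push_cast; rfl
    rw [hv]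
    push_cast
    field_simp
    ring_nf
    simp only [Complex.I_sq]
    ring
  · exact Measurable.aestronglyMeasurable
      ((measurable_gaussianLikelihood σ θ).ennreal_ofReal.ennreal_toReal.smul (by fun_prop))

theorem integral_gaussianLocation (hσ : 0 < σ) (θ : EuclideanSpace ℝ (Fin d))
    (f : EuclideanSpace ℝ (Fin d) → ℝ) :
    ∫ x, f x ∂(gaussianLocation d σ θ) =
      Real.exp (-‖θ‖ ^ 2 / (2 * σ ^ 2)) *
        laplace (gaussianLocation d σ 0) f ((σ ^ 2)⁻¹ • θ) := by
  rw [gaussianLocation_eq_withDensity hσ, integral_withDensity_eq_integral_toReal_smul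
    (measurable_gaussianLikelihood σ θ).ennreal_ofReal (.of_forall fun _ => ENNReal.ofReal_lt_top),
    laplace, ← integral_const_mul]
  refine integral_congr_ae (.of_forall fun x => ?_)
  simp only [smul_eq_mul]
  rw [ENNReal.toReal_ofReal (gaussianLikelihood_nonneg _ _ _), gaussianLikelihood]
  ring

/-- The score function of the Gaussian location model. -/
noncomputable def gaussianScore (σ : ℝ) (θ : EuclideanSpace ℝ (Fin d)) (j : Fin d)
    (x : EuclideanSpace ℝ (Fin d)) : ℝ :=
  (σ ^ 2)⁻¹ * (x j - θ j)

theorem memLp_sub_eval (θ : EuclideanSpace ℝ (Fin d)) (j : Fin d) :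
    MemLp (fun x : EuclideanSpace ℝ (Fin d) => x j - θ j) 2 (gaussianLocation d σ θ) := by
  refine MemLp.sub ?_ (memLp_const _)
  have h := measurePreserving_eval_multivariateGaussian (μ := θ) (posSemidef_sq_smul_one d σ)
    (i := j)
  exact (memLp_id_gaussianReal 2).comp_measurePreserving h

theorem integral_eval_gaussianLocation (θ : EuclideanSpace ℝ (Fin d)) (j : Fin d) :
    ∫ x, x j ∂(gaussianLocation d σ θ) = θ j := by
  have h := measurePreserving_eval_multivariateGaussian (μ := θ) (posSemidef_sq_smul_one d σ)
    (i := j)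
  rw [← integral_id_gaussianReal (μ := θ j), ← h.map_eq, integral_map (by fun_prop) (by fun_prop)]
  rfl

theorem isGaussianScore_gaussianScore (hσ : 0 < σ) (θ : EuclideanSpace ℝ (Fin d)) :
    IsGaussianScore (gaussianLocation d σ θ) (gaussianScore σ θ) (σ ^ 2)⁻¹ := by
  have hexp : ∀ u : Fin d → ℝ, ∫ x, Real.exp (∑ j, u j * gaussianScore σ θ j x)
      ∂(gaussianLocation d σ θ) = Real.exp ((σ ^ 2)⁻¹ * (∑ j, u j ^ 2) / 2) := by
    intro u
    set w : EuclideanSpace ℝ (Fin d) := WithLp.toLp 2 u with hw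
    -- Tilting `N(θ, σ² I)` by its score in direction `w` gives `N(θ + w, σ² I)` up to a constant,
    -- so the moment generating function is read off from total mass `1`.
    have h1 := integral_gaussianLocation hσ (θ + w) fun _ => 1
    rw [integral_const, probReal_univ, one_smul, laplace] at h1
    have h2 : ∀ x, Real.exp (∑ j, u j * gaussianScore σ θ j x) *
        Real.exp (inner ℝ ((σ ^ 2)⁻¹ • θ) x) = Real.exp (-((σ ^ 2)⁻¹ * inner ℝ w θ)) *
        (1 * Real.exp (inner ℝ ((σ ^ 2)⁻¹ • (θ + w)) x)) := by
      intro x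
      rw [one_mul, ← Real.exp_add, ← Real.exp_add]
      congr 1
      have h3 : ∑ j, u j * gaussianScore σ θ j x = (σ ^ 2)⁻¹ * inner ℝ w x -
          (σ ^ 2)⁻¹ * inner ℝ w θ := by
        simp only [gaussianScore, hw, PiLp.inner_apply, RCLike.inner_apply, conj_trivial,
          Finset.mul_sum]
        rw [← Finset.sum_sub_distrib]
        exact Finset.sum_congr rfl fun j _ => by ring
      rw [h3, real_inner_smul_left, real_inner_smul_left, inner_add_left]
      ring
    rw [integral_gaussianLocation hσ, laplace]
    simp_rw [h2]
    rw [integral_const_mul]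
    have h4 : ∑ j, u j ^ 2 = ‖w‖ ^ 2 := by rw [EuclideanSpace.real_norm_sq_eq]
    have h5 : Real.exp (-‖θ‖ ^ 2 / (2 * σ ^ 2)) * Real.exp (-((σ ^ 2)⁻¹ * inner ℝ w θ)) =
        Real.exp ((σ ^ 2)⁻¹ * ‖w‖ ^ 2 / 2) * Real.exp (-‖θ + w‖ ^ 2 / (2 * σ ^ 2)) := by
      rw [← Real.exp_add, ← Real.exp_add, norm_add_sq_real, real_inner_comm]
      congr 1
      field_simp
      ring
    rw [← mul_assoc, h5, h4, mul_assoc, ← h1, mul_one]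
  refine ⟨fun j => (memLp_sub_eval θ j).const_mul _, fun j => ?_, fun j => ?_, fun u => ?_, hexp⟩
  · have hi : Integrable (fun x : EuclideanSpace ℝ (Fin d) => x j) (gaussianLocation d σ θ) := by
      refine (((memLp_sub_eval (σ := σ) θ j).integrable one_le_two).add
        (integrable_const (θ j))).congr (.of_forall fun x => ?_)
      simp
    simp only [gaussianScore]
    rw [integral_const_mul, integral_sub hi (integrable_const _), integral_eval_gaussianLocation]
    simp
  · have hv := variance_eval_multivariateGaussian (μ := θ) (posSemidef_sq_smul_one d σ) j
    rw [variance_eq_integral (by fun_prop)] at hv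
    have hm : ∫ x, x j ∂(multivariateGaussian θ (σ ^ 2 • (1 : Matrix (Fin d) (Fin d) ℝ))) = θ j :=
      integral_eval_gaussianLocation θ j
    simp only [hm] at hv
    simp only [gaussianScore, mul_pow]
    rw [integral_const_mul, gaussianLocation, hv]
    simp
    field_simp
  -- A function that is not integrable has integral `0` by convention, so the positive value already
  -- found proves integrability.
  · refine Integrable.of_integral_ne_zero ?_
    rw [hexp u]
    exact (Real.exp_pos _).ne'

variable {f : EuclideanSpace ℝ (Fin d) → ℝ}

theorem IsExpBounded.differentiable_integral_gaussianLocation (hf : IsExpBounded f) (hσ : 0 < σ) :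
    Differentiable ℝ fun θ : Fin d → ℝ =>
      ∫ x, f x ∂(gaussianLocation d σ (WithLp.toLp 2 θ)) := by
  simp_rw [integral_gaussianLocation hσ, EuclideanSpace.real_norm_sq_eq]
  have hT : Differentiable ℝ fun θ : Fin d → ℝ =>
      (σ ^ 2)⁻¹ • (WithLp.toLp 2 θ : EuclideanSpace ℝ (Fin d)) :=
    ((EuclideanSpace.equiv (Fin d) ℝ).symm.differentiable.const_smul (σ ^ 2)⁻¹ :)
  have h := (hf.differentiable_laplace (gaussianLocation d σ 0)).comp hT
  refine Differentiable.mul ?_ h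
  fun_prop

/-- The right side contains only expectations of functions of exponential growth that do not depend
on `θ`, so the regularity results for those apply to the derivative as well. -/
theorem IsExpBounded.integral_gaussianScore_mul (hf : IsExpBounded f)
    (θ : EuclideanSpace ℝ (Fin d)) (j : Fin d) :
    ∫ x, gaussianScore σ θ j x * f x ∂(gaussianLocation d σ θ) = (σ ^ 2)⁻¹ *
      (∫ x, f x * inner ℝ x (EuclideanSpace.single j 1) ∂(gaussianLocation d σ θ) -
        θ j * ∫ x, f x ∂(gaussianLocation d σ θ)) := by
  rw [← integral_const_mul (θ j), ← integral_sub ((hf.mul (isExpBounded_inner _)).integrable _)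
    ((hf.integrable _).const_mul _), ← integral_const_mul]
  refine integral_congr_ae (.of_forall fun x => ?_)
  simp [gaussianScore, EuclideanSpace.inner_single_right]
  ring

theorem IsExpBounded.continuous_integral_gaussianScore_mul (hf : IsExpBounded f) (hσ : 0 < σ)
    (j : Fin d) : Continuous fun θ : Fin d → ℝ =>
      ∫ x, gaussianScore σ (WithLp.toLp 2 θ) j x * f x
        ∂(gaussianLocation d σ (WithLp.toLp 2 θ)) := by
  simp_rw [hf.integral_gaussianScore_mul]
  have h1 := (hf.differentiable_integral_gaussianLocation hσ).continuous
  have h2 := ((hf.mul (isExpBounded_inner (EuclideanSpace.single j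
    1))).differentiable_integral_gaussianLocation hσ).continuous
  fun_prop

theorem IsExpBounded.hasDerivAt_integral_gaussianLocation (hf : IsExpBounded f) (hσ : 0 < σ)
    (j : Fin d) (θ : Fin d → ℝ) :
    HasDerivAt (fun t => ∫ x, f x ∂(gaussianLocation d σ (WithLp.toLp 2 (Function.update θ j t))))
      (∫ x, gaussianScore σ (WithLp.toLp 2 θ) j x * f x
        ∂(gaussianLocation d σ (WithLp.toLp 2 θ))) (θ j) := by
  rw [hf.integral_gaussianScore_mul]
  simp_rw [integral_gaussianLocation hσ]
  set T : ℝ → EuclideanSpace ℝ (Fin d) := fun t => WithLp.toLp 2 (Function.update θ j t) with hT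
  have hTj : T (θ j) = WithLp.toLp 2 θ := by simp [hT]
  have hd : HasDerivAt T (EuclideanSpace.single j 1) (θ j) :=
    (EuclideanSpace.equiv (Fin d) ℝ).symm.hasFDerivAt.comp_hasDerivAt (θ j)
      (hasDerivAt_update θ j (θ j))
  obtain ⟨L, hL, hLv⟩ := hf.exists_hasFDerivAt_laplace (gaussianLocation d σ 0)
    ((σ ^ 2)⁻¹ • T (θ j))
  have h1 := hL.comp_hasDerivAt (θ j) (hd.const_smul (σ ^ 2)⁻¹)
  have h2 := ((hd.norm_sq.neg).div_const (2 * σ ^ 2)).exp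
  convert! h2.mul h1 using 1
  rw [map_smul, hLv, hTj]
  simp [hTj, EuclideanSpace.inner_single_right]
  field_simp
  ring

end GaussianLocation

/-! ### The risk bound for transcripts of product form -/

section LowerBound

variable {n d : ℕ} {σ : ℝ} {Y : Type*} [Fintype Y]
  {g : Fin n → EuclideanSpace ℝ (Fin d) → Y → ℝ}

theorem IsProductTranscript.isExpBounded (hg : IsProductTranscript g) (i : Fin n) (y : Y) :
    IsExpBounded fun x => g i x y :=
  ⟨hg.measurable i y, 0, fun x => by
    rw [abs_of_nonneg (hg.nonneg i x y), zero_mul, Real.exp_zero]; exact hg.le_one i x y⟩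

theorem IsProductTranscript.transcriptProb_eq {𝒳 : Type*} [MeasurableSpace 𝒳]
    {g : Fin n → 𝒳 → Y → ℝ} (hg : IsProductTranscript g) (ν : Measure 𝒳)
    [IsProbabilityMeasure ν] {p : (Fin n → 𝒳) → Y → ℝ≥0∞}
    (hp : ∀ x y, p x y = ENNReal.ofReal (∏ i, g i (x i) y)) (y : Y) :
    transcriptProb ν p y = ENNReal.ofReal (∏ i, ∫ x, g i x y ∂ν) := by
  rw [transcriptProb, ← integral_fintype_prod_eq_prod (μ := fun _ : Fin n => ν) fun i x => g i x y,
    ofReal_integral_eq_lintegral_ofReal]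
  · simp_rw [hp]
  · exact Integrable.fintype_prod_dep (μ := fun _ : Fin n => ν)
      (f := fun i x => g i x y) fun i => hg.integrable i y
  · exact .of_forall fun x => Finset.prod_nonneg fun i _ => hg.nonneg i (x i) y

theorem IsProductTranscript.gaussianRisk_eq (hg : IsProductTranscript g)
    {p : (Fin n → EuclideanSpace ℝ (Fin d)) → Y → ℝ≥0∞}
    (hp : ∀ x y, p x y = ENNReal.ofReal (∏ i, g i (x i) y))
    (est : Y → EuclideanSpace ℝ (Fin d)) (θ : EuclideanSpace ℝ (Fin d)) :
    gaussianRisk σ p est θ = ENNReal.ofReal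
      (∑ y, (∏ i, ∫ x, g i x y ∂(gaussianLocation d σ θ)) * ∑ j, (est y j - θ j) ^ 2) := by
  have hP : ∀ y, 0 ≤ ∏ i, ∫ x, g i x y ∂(gaussianLocation d σ θ) := fun y =>
    Finset.prod_nonneg fun i _ => hg.integral_nonneg _ i y
  rw [gaussianRisk, ENNReal.ofReal_sum_of_nonneg fun y _ => mul_nonneg (hP y)
    (Finset.sum_nonneg fun j _ => sq_nonneg _)]
  refine Finset.sum_congr rfl fun y _ => ?_
  rw [hg.transcriptProb_eq _ hp, ENNReal.ofReal_mul (hP y), EuclideanSpace.real_norm_sq_eq]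
  simp

open Set in
/-- The van Trees inequality for transcripts of product form in the Gaussian location model. -/
theorem IsProductTranscript.dim_le (hg : IsProductTranscript g) (hd : d ≠ 0) (hσ : 0 < σ) {B R F l : ℝ} (hB : 0 < B) (hl : 0 < l)
    (hF : ∀ θ, fisherTrace (gaussianLocation d σ θ) g (gaussianScore σ θ) ≤ F)
    (est : Y → EuclideanSpace ℝ (Fin d))
    (hR : ∀ θ : EuclideanSpace ℝ (Fin d), (∀ j, θ j ∈ Icc (-B) B) →
      ∑ y, (∏ i, ∫ x, g i x y ∂(gaussianLocation d σ θ)) *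
        ∑ j, (est y j - θ j) ^ 2 ≤ R) :
    (d : ℝ) ≤ l * R + F / (2 * l) + 2 / l * (d : ℝ) *
      (Real.pi / (2 * B)) ^ 2 := by
  obtain ⟨m, rfl⟩ := Nat.exists_eq_add_one_of_ne_zero hd
  set G : Fin n → Y → (Fin (m + 1) → ℝ) → ℝ := fun i y θ =>
    ∫ x, g i x y ∂(gaussianLocation (m + 1) σ (WithLp.toLp 2 θ)) with hG
  set H : Fin n → Y → Fin (m + 1) → (Fin (m + 1) → ℝ) → ℝ := fun i y j θ =>
    ∫ x, gaussianScore σ (WithLp.toLp 2 θ) j x * g i x y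
      ∂(gaussianLocation (m + 1) σ (WithLp.toLp 2 θ)) with hH
  have hGd : ∀ i y, Differentiable ℝ (G i y) := fun i y =>
    (hg.isExpBounded i y).differentiable_integral_gaussianLocation hσ
  have hGc := fun i y => (hGd i y).continuous
  have hHc : ∀ i y j, Continuous (H i y j) := fun i y j =>
    (hg.isExpBounded i y).continuous_integral_gaussianScore_mul hσ j
  refine van_trees (P := fun y θ => ∏ i, G i y θ)
    (P' := fun y j θ => ∑ i, (∏ r ∈ Finset.univ.erase i, G r y θ) • H i y j θ)
    (S := fun y j θ => ∑ i, condMean (gaussianLocation (m + 1) σ (WithLp.toLp 2 θ)) g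
      (gaussianScore σ (WithLp.toLp 2 θ) j) i y) hB hl (fun y => est y)
    (fun y θ => Finset.prod_nonneg fun i _ => hg.integral_nonneg _ i y)
    (fun θ => hg.sum_prod_integral _) (fun y => ?_) (fun y j => ?_) (fun y j θ => ?_)
    (fun y j θ => ?_) (fun θ _ => hF _) (fun θ hθ => ?_)
  · fun_prop
  · fun_prop
  · have h := HasDerivAt.fun_finsetProd (u := Finset.univ) (x := θ j)
      (f := fun i t => G i y (Function.update θ j t)) (f' := fun i => H i y j θ)
      fun i _ => (hg.isExpBounded i y).hasDerivAt_integral_gaussianLocation hσ j θ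
    simpa only [Function.update_eq_self] using h
  · rw [Finset.mul_sum]
    refine Finset.sum_congr rfl fun i _ => ?_
    rw [← Finset.mul_prod_erase _ _ (Finset.mem_univ i), smul_eq_mul]
    have := hg.integral_mul_condMean (gaussianLocation (m + 1) σ (WithLp.toLp 2 θ))
      (gaussianScore σ (WithLp.toLp 2 θ) j) i y
    simp only [hH, hG]
    rw [← this]
    ring
  · exact hR (WithLp.toLp 2 θ) fun j => ⟨hθ.1 j, hθ.2 j⟩

theorem IsProductTranscript.le_iSup_gaussianRisk {k : ℕ} {B : ℝ}
    {Θ : Set (EuclideanSpace ℝ (Fin d))} (hg : IsProductTranscript g) (hσ : 0 < σ) (hB : 0 < B)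
    (hΘ : {θ : EuclideanSpace ℝ (Fin d) | ∀ i, θ i ∈ Set.Icc (-B) B} ⊆ Θ)
    (hN : (d : ℝ) * σ ^ 2 ≤ (n : ℝ) * B ^ 2 * min (k : ℝ) (d : ℝ))
    (hY : Fintype.card Y = 2 ^ (n * k))
    {p : (Fin n → EuclideanSpace ℝ (Fin d)) → Y → ℝ≥0∞}
    (hp : ∀ x y, p x y = ENNReal.ofReal (∏ i, g i (x i) y))
    (est : Y → EuclideanSpace ℝ (Fin d)) :
    ENNReal.ofReal
        (1 / 24 * σ ^ 2 * max ((d : ℝ) ^ 2 / ((n : ℝ) * (k : ℝ))) ((d : ℝ) / (n : ℝ))) ≤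
      ⨆ θ ∈ Θ, gaussianRisk σ p est θ := by
  rcases eq_or_ne d 0 with hd | hd
  · simp [hd]
  have hd0 : (0 : ℝ) < d := by positivity
  by_cases htop : ⨆ θ ∈ Θ, gaussianRisk σ p est θ = ⊤
  · rw [htop]; exact le_top
  rw [ENNReal.ofReal_le_iff_le_toReal htop]
  set R := (⨆ θ ∈ Θ, gaussianRisk σ p est θ).toReal
  have hR : ∀ θ : EuclideanSpace ℝ (Fin d), (∀ j, θ j ∈ Set.Icc (-B) B) →
      ∑ y, (∏ i, ∫ x, g i x y ∂(gaussianLocation d σ θ)) * ∑ j, (est y j - θ j) ^ 2 ≤ R := by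
    intro θ hθ
    have h := le_iSup₂ (f := fun θ (_ : θ ∈ Θ) => gaussianRisk σ p est θ) θ (hΘ hθ)
    rw [hg.gaussianRisk_eq hp, ENNReal.ofReal_le_iff_le_toReal htop] at h
    exact h
  -- Once `d` is positive, this forces `n` and `k` to be positive too.
  have hpos : 0 < (n : ℝ) * B ^ 2 * min (k : ℝ) (d : ℝ) := lt_of_lt_of_le (by positivity) hN
  have hn : (0 : ℝ) < n := by
    by_contra h
    have : (n : ℝ) = 0 := le_antisymm (not_lt.mp h) (Nat.cast_nonneg n)
    rw [this] at hpos; simp at hpos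
  have hμ : 0 < min (k : ℝ) (d : ℝ) := pos_of_mul_pos_right hpos (by positivity)
  have hk : (0 : ℝ) < k := lt_of_lt_of_le hμ (min_le_left _ _)
  set μ : ℝ := min (k : ℝ) (d : ℝ) with hμdef
  set N : ℝ := n * μ / σ ^ 2 with hNdef
  have hN0 : 0 < N := by positivity
  have hF : ∀ θ, fisherTrace (gaussianLocation d σ θ) g (gaussianScore σ θ) ≤ 2 * N := by
    intro θ
    have hs := isGaussianScore_gaussianScore hσ θ
    have h1 := hg.fisherTrace_le_dim hs
    have h2 := hg.fisherTrace_le_log_card (by positivity) hs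
    have h3 : Real.log (Fintype.card Y) ≤ n * k := by
      rw [hY]; push_cast
      rw [Real.log_pow]; push_cast
      have := Real.log_two_lt_d9
      exact mul_le_of_le_one_right (by positivity) (by linarith)
    -- The entropy bound serves when the minimum is `k`, the dimension bound when it is `d`.
    rcases min_choice (k : ℝ) (d : ℝ) with h | h
    · refine h2.trans ((mul_le_mul_of_nonneg_left h3 (by positivity)).trans (le_of_eq ?_))
      rw [hNdef, hμdef, h]; field_simp
    · refine h1.trans ?_
      have h4 : (d : ℝ) * n * (σ ^ 2)⁻¹ = N := by
        rw [hNdef, hμdef, h]; field_simp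
      rw [h4]; linarith
  -- With `l = 12 * N / d` the Fisher term is `d / 12` and the prior term at most `5 * d / 12`. This
  -- leaves `d / 2 ≤ l * R`, whence the constant `1 / 24`.
  have hl : 0 < 12 * N / d := by positivity
  have key := hg.dim_le hd hσ hB hl hF est hR
  have hdN : (d : ℝ) * (Real.pi / (2 * B)) ^ 2 ≤ 5 / 2 * N := by
    have h1 : (d : ℝ) ≤ N * B ^ 2 := by
      rw [hNdef, div_mul_eq_mul_div, le_div_iff₀ (by positivity)]
      linarith
    have h2 : Real.pi ^ 2 ≤ 10 := by
      have := Real.pi_lt_d2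
      have := Real.pi_pos
      nlinarith
    calc (d : ℝ) * (Real.pi / (2 * B)) ^ 2 ≤ (N * B ^ 2) * (Real.pi / (2 * B)) ^ 2 := by gcongr
      _ = N * Real.pi ^ 2 / 4 := by field_simp; ring
      _ ≤ 5 / 2 * N := by nlinarith
  have h5 : 2 / (12 * N / d) * (d : ℝ) * (Real.pi / (2 * B)) ^ 2 ≤
      2 / (12 * N / d) * (5 / 2 * N) := by
    rw [mul_assoc]
    exact mul_le_mul_of_nonneg_left hdN (by positivity)
  have h6 : 2 * N / (2 * (12 * N / d)) + 2 / (12 * N / d) * (5 / 2 * N) = (d : ℝ) / 2 := by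
    field_simp; ring
  have h7 : (d : ℝ) / 2 ≤ 12 * N / d * R := by linarith
  have h8 : 1 / 24 * σ ^ 2 * ((d : ℝ) ^ 2 / (n * μ)) ≤ R := by
    rw [div_mul_eq_mul_div, le_div_iff₀ hd0] at h7
    have h9 : 1 / 24 * σ ^ 2 * ((d : ℝ) ^ 2 / (n * μ)) = (d : ℝ) / 2 * d / (12 * N) := by
      rw [hNdef]; field_simp; ring
    rw [h9, div_le_iff₀ (by positivity)]
    linarith
  -- Both entries of the maximum are at most `d ^ 2 / (n * μ)`, by `μ ≤ k` and `μ ≤ d` respectively.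
  refine le_trans (mul_le_mul_of_nonneg_left (max_le ?_ ?_) (by positivity)) h8
  · gcongr
    exact min_le_left _ _
  · rw [div_le_div_iff₀ hn (by positivity)]
    have : μ ≤ d := min_le_right _ _
    nlinarith [mul_pos hd0 hn]

end LowerBound

/-! ### Product form of the three kinds of protocols -/

section Protocols

variable {n k : ℕ} {𝒳 : Type*} [MeasurableSpace 𝒳]

theorem sum_toReal_singleton_eq_one {A : Type*} [Fintype A] [MeasurableSpace A]
    [MeasurableSingletonClass A] (μ : Measure A) [IsProbabilityMeasure μ] :
    ∑ a, (μ {a}).toReal = 1 := by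
  rw [← ENNReal.toReal_sum fun a _ => measure_ne_top _ _, sum_measure_singleton]
  simp

/-- An independent protocol is a sequential one that ignores the previous messages. -/
def IndependentProtocol.toSequential (P : IndependentProtocol n k 𝒳) :
    SequentialProtocol n k 𝒳 :=
  ⟨fun i _ => P.q i, fun i _ => P.isMarkovKernel i⟩

/-- The factors of the transcript probabilities of a sequential protocol. -/
noncomputable def SequentialProtocol.factor (P : SequentialProtocol n k 𝒳) (i : Fin n) (x : 𝒳)
    (y : Fin n → Fin (2 ^ k)) : ℝ :=
  (P.q i (before y i) x {y i}).toReal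

theorem SequentialProtocol.isProductTranscript (P : SequentialProtocol n k 𝒳) :
    IsProductTranscript P.factor where
  measurable i y := ((P.q i (before y i)).measurable_coe (measurableSet_singleton _)).ennreal_toReal
  nonneg _ _ _ := ENNReal.toReal_nonneg
  le_one i x y := by
    have := P.isMarkovKernel i (before y i)
    exact ENNReal.toReal_le_of_le_ofReal one_pos.le (by simpa using prob_le_one)
  sum_prod x := sum_prod_before_eq_one (fun i v a => (P.q i v (x i) {a}).toReal) fun i v => by
    have := P.isMarkovKernel i v
    exact sum_toReal_singleton_eq_one _

theorem SequentialProtocol.condProb_eq (P : SequentialProtocol n k 𝒳) (x : Fin n → 𝒳)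
    (y : Fin n → Fin (2 ^ k)) :
    P.condProb x y = ENNReal.ofReal (∏ i, P.factor i (x i) y) := by
  rw [ENNReal.ofReal_prod_of_nonneg fun i _ => P.isProductTranscript.nonneg i (x i) y, condProb]
  refine Finset.prod_congr rfl fun i _ => ?_
  have := P.isMarkovKernel i (before y i)
  rw [factor, ENNReal.ofReal_toReal (measure_ne_top _ _)]

/-- The probability that a node with sample `x` writes the bit `a` at the vertex `v`. -/
def BlackboardProtocol.bitWeight (P : BlackboardProtocol n k 𝒳) (t : Fin (n * k))
    (v : Fin (t : ℕ) → Bool) (x : 𝒳) (a : Bool) : ℝ :=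
  if a = true then P.bitProb t v x else 1 - P.bitProb t v x

theorem BlackboardProtocol.bitWeight_mem (P : BlackboardProtocol n k 𝒳) (t : Fin (n * k))
    (v : Fin (t : ℕ) → Bool) (x : 𝒳) (a : Bool) : P.bitWeight t v x a ∈ Set.Icc (0 : ℝ) 1 := by
  have h := P.bitProb_mem t v x
  unfold bitWeight
  split_ifs
  · exact h
  · exact ⟨sub_nonneg.mpr h.2, by linarith [h.1]⟩

/-- The factors of the transcript probabilities of a blackboard protocol. -/
def BlackboardProtocol.factor (P : BlackboardProtocol n k 𝒳) (i : Fin n) (x : 𝒳)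
    (y : Fin (n * k) → Bool) : ℝ :=
  ∏ t with P.label t (before y t) = i, P.bitWeight t (before y t) x (y t)

/-- Once the transcript is fixed, so is the path in the tree and hence the writer of each bit.
Grouping the bits by writer separates the samples, even though the nodes interact. -/
theorem BlackboardProtocol.prod_factor (P : BlackboardProtocol n k 𝒳) (x : Fin n → 𝒳)
    (y : Fin (n * k) → Bool) :
    ∏ i, P.factor i (x i) y =
      ∏ t, P.bitWeight t (before y t) (x (P.label t (before y t))) (y t) := by
  rw [← Finset.prod_fiberwise Finset.univ fun t => P.label t (before y t)]
  refine Finset.prod_congr rfl fun i _ => Finset.prod_congr rfl fun t ht => ?_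
  rw [(Finset.mem_filter.mp ht).2]

theorem BlackboardProtocol.isProductTranscript (P : BlackboardProtocol n k 𝒳) :
    IsProductTranscript P.factor where
  measurable i y := Finset.measurable_fun_prod _ fun t _ => by
    have := P.measurable_bitProb t (before y t)
    unfold bitWeight
    split_ifs
    · exact this
    · exact this.const_sub 1
  nonneg _ _ _ := Finset.prod_nonneg fun _ _ => (P.bitWeight_mem _ _ _ _).1
  le_one _ _ _ := Finset.prod_le_one (fun _ _ => (P.bitWeight_mem _ _ _ _).1)
    fun _ _ => (P.bitWeight_mem _ _ _ _).2
  sum_prod x := by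
    simp_rw [P.prod_factor]
    exact sum_prod_before_eq_one (fun t v a => P.bitWeight t v (x (P.label t v)) a) fun t v => by
      simp [bitWeight]

theorem BlackboardProtocol.condProb_eq (P : BlackboardProtocol n k 𝒳) (x : Fin n → 𝒳)
    (y : Fin (n * k) → Bool) :
    P.condProb x y = ENNReal.ofReal (∏ i, P.factor i (x i) y) := by
  rw [P.prod_factor, ENNReal.ofReal_prod_of_nonneg fun _ _ => (P.bitWeight_mem _ _ _ _).1]
  rfl

end Protocols

theorem mainTheorem5 :
    ∃ C : ℝ, 0 < C ∧
      ∀ (n k d : ℕ) (σ B : ℝ) (Θ : Set (EuclideanSpace ℝ (Fin d))),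
        0 < σ → 0 < B →
        {θ : EuclideanSpace ℝ (Fin d) | ∀ i, θ i ∈ Set.Icc (-B) B} ⊆ Θ →
        (d : ℝ) * σ ^ 2 ≤ (n : ℝ) * B ^ 2 * min (k : ℝ) (d : ℝ) →
        (∀ (P : IndependentProtocol n k (EuclideanSpace ℝ (Fin d)))
            (est : (Fin n → Fin (2 ^ k)) → EuclideanSpace ℝ (Fin d)),
          ENNReal.ofReal
              (C * σ ^ 2 * max ((d : ℝ) ^ 2 / ((n : ℝ) * (k : ℝ))) ((d : ℝ) / (n : ℝ))) ≤
            ⨆ θ ∈ Θ, gaussianRisk σ P.condProb est θ) ∧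
        (∀ (P : SequentialProtocol n k (EuclideanSpace ℝ (Fin d)))
            (est : (Fin n → Fin (2 ^ k)) → EuclideanSpace ℝ (Fin d)),
          ENNReal.ofReal
              (C * σ ^ 2 * max ((d : ℝ) ^ 2 / ((n : ℝ) * (k : ℝ))) ((d : ℝ) / (n : ℝ))) ≤
            ⨆ θ ∈ Θ, gaussianRisk σ P.condProb est θ) ∧
        (∀ (P : BlackboardProtocol n k (EuclideanSpace ℝ (Fin d)))
            (est : (Fin (n * k) → Bool) → EuclideanSpace ℝ (Fin d)),
          ENNReal.ofReal
              (C * σ ^ 2 * max ((d : ℝ) ^ 2 / ((n : ℝ) * (k : ℝ))) ((d : ℝ) / (n : ℝ))) ≤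
            ⨆ θ ∈ Θ, gaussianRisk σ P.condProb est θ) := by
  refine ⟨1 / 24, by norm_num, fun n k d σ B Θ hσ hB hΘ hN => ?_⟩
  have hseq : ∀ (P : SequentialProtocol n k (EuclideanSpace ℝ (Fin d)))
      (est : (Fin n → Fin (2 ^ k)) → EuclideanSpace ℝ (Fin d)),
      ENNReal.ofReal
          (1 / 24 * σ ^ 2 * max ((d : ℝ) ^ 2 / ((n : ℝ) * (k : ℝ))) ((d : ℝ) / (n : ℝ))) ≤
        ⨆ θ ∈ Θ, gaussianRisk σ P.condProb est θ := fun P est =>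
    P.isProductTranscript.le_iSup_gaussianRisk hσ hB hΘ hN
      (by simp [← pow_mul, mul_comm]) P.condProb_eq est
  -- The conditional probabilities of `P.toSequential` agree by definition with those of `P`.
  exact ⟨fun P est => hseq P.toSequential est, hseq, fun P est =>
    P.isProductTranscript.le_iSup_gaussianRisk hσ hB hΘ hN (by simp) P.condProb_eq est⟩
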